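/- Let $d \ge 1$ and let $\mathbb{Z}^d$ be the square lattice, in which two vertices are joined by an edge if and only if their $\ell^1$-distance is $1$. Let $(t(e))_e$, indexed by the edges $e$ of $\mathbb{Z}^d$, be independent (not necessarily identically distributed) real random variables on a probability space, the passage times of the edges. For a finite self-avoiding path $\pi$ put $T(\pi)=\sum_{e\in\pi}t(e)$, and for $n\ge 1$ let $$T_n=\inf_{\pi}T(\pi),$$ the infimum being over all finite self-avoiding paths $\pi$ with endvertices the origin and $(n,0,\ldots,0)$. Consider the conditions - (i) $\sup_e \mathbb{P}(t(e)<\epsilon)\to 0$ as $\epsilon\downarrow 0$; - (ii) $\sup_e \mathbb{E}\,t(e)^2<\infty$; - (ii)(a) $\sup_e \mathbb{E}\big[t(e)^2\,\mathbf{1}(t(e)\ge M)\big]\to 0$ as $M\to\infty$; - (ii)(b) $\sup_e \mathbb{E}\,t(e)^p<\infty$ for some real $p>2$. (Condition (i) implies that $t(e)>0$ almost surely for every $e$.) Then the following hold. 1. If (i) and (ii) hold, then each $T_n$ is integrable and $\frac1n(T_n-\mathbb{E}T_n)\to 0$ almost surely and in $L^1$ as $n\to\infty$. 2. If (i) and (ii)(a)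 hold, then each $T_n$ is square integrable and $\frac1n(T_n-\mathbb{E}T_n)\to 0$ almost surely and in $L^2$. 3. If (i) and (ii)(b) hold, then each $T_n$ is square integrable, $\frac1n(T_n-\mathbb{E}T_n)\to 0$ almost surely and in $L^2$, and there is a constant $C>0$ with $\operatorname{var}(T_n)\le Cn$ for all $n\ge 1$. In each of the three cases there are constants $0<\eta_1\le\eta_2<\infty$ such that $$\eta_1\le\liminf_{n\to\infty}\frac{T_n}{n}\le\limsup_{n\to\infty}\frac{T_n}{n}\le\eta_2\quad\text{almost surely.}$$ -/

import Mathlib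

open MeasureTheory ProbabilityTheory Filter Topology
open scoped ENNReal

namespace FPP

/-- The square lattice `ℤ^d`: two vertices are adjacent iff their `ℓ¹`-distance is `1`. -/
def lattice (d : ℕ) : SimpleGraph (Fin d → ℤ) where
  Adj x y := ∑ i, |x i - y i| = 1
  symm := ⟨fun x y h => by simpa only [abs_sub_comm] using h⟩
  loopless := ⟨fun x h => by simp at h⟩

/-- The edges of `ℤ^d`. -/
abbrev Edge (d : ℕ) : Type := (lattice d).edgeSet

/-- The point `(n, 0, …, 0)`. -/
def axisPoint (d : ℕ) [NeZero d] (n : ℕ) : Fin d → ℤ := Pi.single 0 (n : ℤ)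

/-- The passage time of a walk for the edge weights `τ`: the sum of the weights of the edges
traversed. (For a self-avoiding path each edge occurs once.) -/
noncomputable def walkTime {d : ℕ} (τ : Edge d → ℝ) {x y : Fin d → ℤ}
    (w : (lattice d).Walk x y) : ℝ :=
  (w.darts.map fun a => τ ⟨a.edge, a.edge_mem⟩).sum

/-- The minimum passage time `T_n`: the infimum of the passage times of all finite self-avoiding
paths from the origin to `(n, 0, …, 0)`. -/
noncomputable def minTime {d : ℕ} [NeZero d] {Ω : Type*} (t : Edge d → Ω → ℝ) (n : ℕ) (ω : Ω) :
    ℝ :=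
  ⨅ π : (lattice d).Path 0 (axisPoint d n), walkTime (fun e => t e ω) π.1

section Conditions

variable {d : ℕ} {Ω : Type*} [MeasurableSpace Ω]

/-- `sup_e P(t(e) < ε) → 0` as `ε ↓ 0`. -/
def NoMassNearZero (P : Measure Ω) (t : Edge d → Ω → ℝ) : Prop :=
  Tendsto (fun ε : ℝ => ⨆ e, P {ω | t e ω < ε}) (𝓝[>] 0) (𝓝 0)

/-- `sup_e E t(e)² < ∞`. -/
def BoundedSecondMoments (P : Measure Ω) (t : Edge d → Ω → ℝ) : Prop :=
  (⨆ e, ∫⁻ ω, ENNReal.ofReal (t e ω ^ 2) ∂P) < ∞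

/-- `sup_e E [t(e)² 1(t(e) ≥ M)] → 0` as `M → ∞`. -/
def UnifIntegrableSquares (P : Measure Ω) (t : Edge d → Ω → ℝ) : Prop :=
  Tendsto (fun M : ℝ => ⨆ e, ∫⁻ ω in {ω | M ≤ t e ω}, ENNReal.ofReal (t e ω ^ 2) ∂P)
    atTop (𝓝 0)

/-- `sup_e E t(e)^p < ∞` for some real `p > 2`. -/
def BoundedHigherMoments (P : Measure Ω) (t : Edge d → Ω → ℝ) : Prop :=
  ∃ p : ℝ, 2 < p ∧ (⨆ e, ∫⁻ ω, ENNReal.ofReal (t e ω ^ p) ∂P) < ∞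

end Conditions

section Conclusions

variable {d : ℕ} [NeZero d] {Ω : Type*} [MeasurableSpace Ω]

/-- `(T_n - E T_n) / n`. -/
noncomputable def centredTime (P : Measure Ω) (t : Edge d → Ω → ℝ) (n : ℕ) (ω : Ω) : ℝ :=
  (minTime t n ω - ∫ ω', minTime t n ω' ∂P) / n

/-- `(T_n - E T_n) / n → 0` almost surely. -/
def ConvergesAS (P : Measure Ω) (t : Edge d → Ω → ℝ) : Prop :=
  ∀ᵐ ω ∂P, Tendsto (fun n => centredTime P t n ω) atTop (𝓝 0)

/-- Every `T_n` is in `L^q`, and `(T_n - E T_n) / n → 0` in `L^q`. -/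
def ConvergesInLp (q : ℝ≥0∞) (P : Measure Ω) (t : Edge d → Ω → ℝ) : Prop :=
  (∀ n, MemLp (minTime t n) q P) ∧
    Tendsto (fun n => eLpNorm (centredTime P t n) q P) atTop (𝓝 0)

/-- There are constants `0 < η₁ ≤ η₂ < ∞` with `η₁ ≤ liminf T_n/n ≤ limsup T_n/n ≤ η₂` almost
surely; the limits are taken in the extended reals. -/
def NontrivialGrowth (P : Measure Ω) (t : Edge d → Ω → ℝ) : Prop :=
  ∃ η₁ η₂ : ℝ, 0 < η₁ ∧ η₁ ≤ η₂ ∧ ∀ᵐ ω ∂P,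
    (η₁ : EReal) ≤ liminf (fun n : ℕ => ((minTime t n ω / n : ℝ) : EReal)) atTop ∧
    liminf (fun n : ℕ => ((minTime t n ω / n : ℝ) : EReal)) atTop ≤
      limsup (fun n : ℕ => ((minTime t n ω / n : ℝ) : EReal)) atTop ∧
    limsup (fun n : ℕ => ((minTime t n ω / n : ℝ) : EReal)) atTop ≤ (η₂ : EReal)

/-- `var(T_n) ≤ C n` for some constant `C > 0` and all `n ≥ 1`. -/
def LinearVariance (P : Measure Ω) (t : Edge d → Ω → ℝ) : Prop :=
  ∃ C : ℝ, 0 < C ∧ ∀ n : ℕ, 1 ≤ n → variance (minTime t n) P ≤ C * n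

end Conclusions

end FPP

/-!
By the Efron–Stein inequality, the variance of a minimum of sums of independent nonnegative weights
is at most the largest second moment times the expected number of pivotal weights, those common to
all minimising sums; for `T_n` this number is at most the length of a fastest path. A Chernoff bound
over the at most `(2 * d) ^ k` paths of length `k` from the origin shows that all but finitely many
of them have passage time at least `a * k`, hence that a fastest path has length at most
`(T_n + R) / a` with `R` integrable. So `Var T_n` grows at most linearly. The second moments of
`(T_n - E T_n) / n` are then summable along the squares, and since `|T_{n+1} - T_n|` is at most the
passage time of one edge, the almost sure convergence extends to all `n`.
-/

namespace FPP

section EfronStein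

lemma integral_mul_sub_le_half_integral_sq {Ω : Type*} [MeasurableSpace Ω] {ν : Measure Ω}
    {u u' v v' : Ω → ℝ} (hu : MemLp u 2 ν) (hu' : MemLp u' 2 ν) (hv : MemLp v 2 ν)
    (hv' : MemLp v' 2 ν)
    (hswap : ∫ ω, u ω * (v ω - v' ω) ∂ν = ∫ ω, u' ω * (v' ω - v ω) ∂ν)
    (hsq : ∫ ω, (v' ω - v ω) ^ 2 ∂ν = ∫ ω, (u' ω - u ω) ^ 2 ∂ν) :
    ∫ ω, u ω * (v ω - v' ω) ∂ν ≤ 1 / 2 * ∫ ω, (u' ω - u ω) ^ 2 ∂ν := by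
  have hI : Integrable (fun ω => u ω * (v ω - v' ω)) ν := hu.integrable_mul (hv.sub hv')
  have hI' : Integrable (fun ω => u' ω * (v' ω - v ω)) ν := hu'.integrable_mul (hv'.sub hv)
  have hsqu : Integrable (fun ω => (u' ω - u ω) ^ 2) ν := (hu'.sub hu).integrable_sq
  have hsqv : Integrable (fun ω => (v' ω - v ω) ^ 2) ν := (hv'.sub hv).integrable_sq
  have hle : ∫ ω, (u ω * (v ω - v' ω) + u' ω * (v' ω - v ω)) ∂ν ≤
      ∫ ω, (1 / 2 * (u' ω - u ω) ^ 2 + 1 / 2 * (v' ω - v ω) ^ 2) ∂ν :=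
    integral_mono (hI.add hI') ((hsqu.const_mul _).add (hsqv.const_mul _)) fun ω => by
      nlinarith only [sq_nonneg ((u' ω - u ω) - (v' ω - v ω))]
  rw [integral_add hI hI', integral_add (hsqu.const_mul _) (hsqv.const_mul _),
    integral_const_mul, integral_const_mul] at hle
  linarith

lemma variance_eq_integral_mul_sub {Ω : Type*} [MeasurableSpace Ω] {P : Measure Ω}
    [IsProbabilityMeasure P] {f : Ω → ℝ} (hf : MemLp f 2 P) :
    Var[f; P] = ∫ z, f z.1 * (f z.1 - f z.2) ∂(P.prod P) := by
  have hfst := hf.comp_measurePreserving (measurePreserving_fst (ν := P))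
  have hsnd := hf.comp_measurePreserving (measurePreserving_snd (μ := P))
  have hsq : Integrable (fun z : Ω × Ω => f z.1 ^ 2) (P.prod P) := hfst.integrable_sq
  have hmul : Integrable (fun z : Ω × Ω => f z.1 * f z.2) (P.prod P) :=
    hfst.integrable_mul hsnd
  simp only [mul_sub, ← sq]
  rw [integral_sub hsq hmul, integral_prod_mul f f, variance_eq_sub hf,
    integral_fun_fst (fun x => f x ^ 2)]
  simp [sq]

variable {ι α : Type*} [DecidableEq ι]

/-- Exchange of the coordinates in `A` between the two configurations of a pair; resampling a
coordinate is the first component of an exchange with an independent copy. -/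
def exchange (A : Finset ι) (z : (ι → α) × (ι → α)) : (ι → α) × (ι → α) :=
  (A.piecewise z.2 z.1, A.piecewise z.1 z.2)

lemma exchange_empty (z : (ι → α) × (ι → α)) : exchange ∅ z = z := by
  simp [exchange]

lemma exchange_univ_fst [Fintype ι] (z : (ι → α) × (ι → α)) :
    (exchange Finset.univ z).1 = z.2 := by
  simp [exchange]

lemma exchange_singleton_fst (k : ι) (z : (ι → α) × (ι → α)) :
    (exchange {k} z).1 = Function.update z.1 k (z.2 k) := by
  simp [exchange, Finset.piecewise_singleton]

lemma exchange_involutive (A : Finset ι) :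
    Function.Involutive (exchange A : (ι → α) × (ι → α) → _) := fun z => by
  ext i <;> by_cases hA : i ∈ A <;> simp_all [exchange, Finset.piecewise]

lemma exchange_singleton_exchange {A : Finset ι} {k : ι} (hk : k ∉ A)
    (z : (ι → α) × (ι → α)) : exchange {k} (exchange A z) = exchange (insert k A) z := by
  ext i <;> by_cases hi : i = k <;> by_cases hA : i ∈ A <;>
    simp_all [exchange, Finset.piecewise]

lemma exchange_exchange_singleton {A : Finset ι} {k : ι} (hk : k ∉ A)
    (z : (ι → α) × (ι → α)) : exchange A (exchange {k} z) = exchange (insert k A) z := by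
  ext i <;> by_cases hi : i = k <;> by_cases hA : i ∈ A <;>
    simp_all [exchange, Finset.piecewise]

variable [Fintype ι] [MeasurableSpace α] (μ : ι → Measure α) [∀ i, IsProbabilityMeasure (μ i)]
  {f : (ι → α) → ℝ}

lemma measurePreserving_exchange (A : Finset ι) :
    MeasurePreserving (exchange A) ((Measure.pi μ).prod (Measure.pi μ))
      ((Measure.pi μ).prod (Measure.pi μ)) := by
  have hzip := measurePreserving_arrowProdEquivProdArrow α α ι μ μ
  have hswap : MeasurePreserving
      (fun (p : ι → α × α) i => (if i ∈ A then Prod.swap else id) (p i))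
      (Measure.pi fun i => (μ i).prod (μ i)) (Measure.pi fun i => (μ i).prod (μ i)) := by
    refine measurePreserving_pi _ _ fun i => ?_
    by_cases hi : i ∈ A
    · simpa [hi] using Measure.measurePreserving_swap
    · simpa [hi] using MeasurePreserving.id _
  convert hzip.comp (hswap.comp hzip.symm) using 1
  ext z i <;> by_cases hi : i ∈ A <;>
    simp [exchange, MeasurableEquiv.arrowProdEquivProdArrow, Equiv.arrowProdEquivProdArrow, hi,
      Finset.piecewise]

lemma integral_comp_exchange (A : Finset ι) (g : (ι → α) × (ι → α) → ℝ) :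
    ∫ z, g (exchange A z) ∂((Measure.pi μ).prod (Measure.pi μ)) =
      ∫ z, g z ∂((Measure.pi μ).prod (Measure.pi μ)) :=
  have hpres := measurePreserving_exchange μ A
  hpres.integral_comp
    (MeasurableEquiv.ofInvolutive _ (exchange_involutive A) hpres.measurable).measurableEmbedding g

lemma memLp_comp_exchange (hf : MemLp f 2 (Measure.pi μ)) (A : Finset ι) :
    MemLp (fun z => f (exchange A z).1) 2 ((Measure.pi μ).prod (Measure.pi μ)) :=
  (hf.comp_measurePreserving measurePreserving_fst).comp_measurePreserving
    (measurePreserving_exchange μ A)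

lemma integral_mul_exchange_sub_exchange_insert_le (hf : MemLp f 2 (Measure.pi μ))
    {A : Finset ι} {k : ι} (hk : k ∉ A) :
    ∫ z, f z.1 * (f (exchange A z).1 - f (exchange (insert k A) z).1)
        ∂((Measure.pi μ).prod (Measure.pi μ)) ≤
      1 / 2 * ∫ z, (f (exchange {k} z).1 - f z.1) ^ 2
        ∂((Measure.pi μ).prod (Measure.pi μ)) := by
  refine integral_mul_sub_le_half_integral_sq (hf.comp_measurePreserving measurePreserving_fst)
    (memLp_comp_exchange μ hf {k}) (memLp_comp_exchange μ hf A)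
    (memLp_comp_exchange μ hf (insert k A)) ?_ ?_
  · rw [← integral_comp_exchange μ {k}]
    simp only [exchange_exchange_singleton hk, ← exchange_singleton_exchange hk,
      exchange_involutive {k} _]
  · rw [← integral_comp_exchange μ A fun z => (f (exchange {k} z).1 - f z.1) ^ 2]
    simp only [exchange_singleton_exchange hk]

lemma integral_mul_sub_exchange_le (hf : MemLp f 2 (Measure.pi μ)) (A : Finset ι) :
    ∫ z, f z.1 * (f z.1 - f (exchange A z).1) ∂((Measure.pi μ).prod (Measure.pi μ)) ≤
      ∑ k ∈ A, 1 / 2 * ∫ z, (f (exchange {k} z).1 - f z.1) ^ 2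
        ∂((Measure.pi μ).prod (Measure.pi μ)) := by
  have hfst := hf.comp_measurePreserving (measurePreserving_fst (ν := Measure.pi μ))
  have hex := memLp_comp_exchange μ hf
  induction A using Finset.induction_on with
  | empty => simp [exchange_empty]
  | insert k A hk ih =>
    rw [Finset.sum_insert hk]
    calc _ = ∫ z, (f z.1 * (f (exchange A z).1 - f (exchange (insert k A) z).1) +
            f z.1 * (f z.1 - f (exchange A z).1)) ∂((Measure.pi μ).prod (Measure.pi μ)) := by
          congr with z
          ring
      _ = ∫ z, f z.1 * (f (exchange A z).1 - f (exchange (insert k A) z).1)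
            ∂((Measure.pi μ).prod (Measure.pi μ)) +
          ∫ z, f z.1 * (f z.1 - f (exchange A z).1) ∂((Measure.pi μ).prod (Measure.pi μ)) :=
        integral_add (hfst.integrable_mul ((hex A).sub (hex (insert k A))))
          (hfst.integrable_mul (hfst.sub (hex A)))
      _ ≤ _ := add_le_add (integral_mul_exchange_sub_exchange_insert_le μ hf hk) ih

lemma half_integral_sq_eq_integral_posPart (hf : MemLp f 2 (Measure.pi μ)) (k : ι) :
    1 / 2 * ∫ z, (f (exchange {k} z).1 - f z.1) ^ 2 ∂((Measure.pi μ).prod (Measure.pi μ)) =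
      ∫ z, (max (f (exchange {k} z).1 - f z.1) 0) ^ 2
        ∂((Measure.pi μ).prod (Measure.pi μ)) := by
  have hfst := hf.comp_measurePreserving (measurePreserving_fst (ν := Measure.pi μ))
  have hdiff : MemLp (fun z => f (exchange {k} z).1 - f z.1) 2
      ((Measure.pi μ).prod (Measure.pi μ)) := (memLp_comp_exchange μ hf {k}).sub hfst
  have hsplit (x : ℝ) : x ^ 2 = max x 0 ^ 2 + max (-x) 0 ^ 2 := by
    rcases le_total 0 x with h | h <;> simp [h]
  have hsymm : ∫ z, (max (-(f (exchange {k} z).1 - f z.1)) 0) ^ 2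
        ∂((Measure.pi μ).prod (Measure.pi μ)) =
      ∫ z, (max (f (exchange {k} z).1 - f z.1) 0) ^ 2
        ∂((Measure.pi μ).prod (Measure.pi μ)) := by
    rw [← integral_comp_exchange μ {k}]
    simp only [exchange_involutive {k} _, neg_sub]
  simp only [hsplit (f (exchange {k} _).1 - _)]
  rw [integral_add hdiff.pos_part.integrable_sq hdiff.neg_part.integrable_sq, hsymm]
  ring

/-- The **Efron–Stein inequality**. -/
theorem variance_le_sum_integral_sq_posPart (hf : MemLp f 2 (Measure.pi μ)) :
    Var[f; Measure.pi μ] ≤ ∑ k, ∫ z, (max (f (Function.update z.1 k (z.2 k)) - f z.1) 0) ^ 2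
      ∂((Measure.pi μ).prod (Measure.pi μ)) :=
  calc Var[f; Measure.pi μ]
      = ∫ z, f z.1 * (f z.1 - f (exchange Finset.univ z).1)
          ∂((Measure.pi μ).prod (Measure.pi μ)) := by
        simp only [variance_eq_integral_mul_sub hf, exchange_univ_fst]
    _ ≤ _ := integral_mul_sub_exchange_le μ hf Finset.univ
    _ = _ := by
        simp_rw [half_integral_sq_eq_integral_posPart μ hf, exchange_singleton_fst]

end EfronStein

section MinimumOfSums

variable {ι κ : Type*}

lemma measurable_iInf_sum {Ω : Type*} [MeasurableSpace Ω] [Countable κ] {t : ι → Ω → ℝ}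
    (ht : ∀ i, Measurable (t i)) (A : κ → Finset ι) :
    Measurable fun ω => ⨅ k, ∑ i ∈ A k, t i ω :=
  Measurable.iInf fun k => Finset.measurable_sum (A k) fun i _ => ht i

lemma memLp_iInf_sum {Ω : Type*} [MeasurableSpace Ω] {P : Measure Ω} [Countable κ]
    {t : ι → Ω → ℝ} {p : ℝ≥0∞} (ht : ∀ i, Measurable (t i)) (h0 : ∀ᵐ ω ∂P, ∀ i, 0 ≤ t i ω)
    (hp : ∀ i, MemLp (t i) p P) (A : κ → Finset ι) (k₀ : κ) :
    MemLp (fun ω => ⨅ k, ∑ i ∈ A k, t i ω) p P := by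
  refine (memLp_finsetSum (A k₀) fun i _ => hp i).of_le
    (measurable_iInf_sum ht A).aestronglyMeasurable ?_
  filter_upwards [h0] with ω hω
  have hsum (k : κ) : 0 ≤ ∑ i ∈ A k, t i ω := Finset.sum_nonneg fun i _ => hω i
  rw [Real.norm_of_nonneg (Real.iInf_nonneg hsum), Real.norm_of_nonneg (hsum k₀)]
  exact ciInf_le ⟨0, Set.forall_mem_range.2 hsum⟩ k₀

/-- The coordinate `i` is pivotal for the weights `x` if it lies in every set of the family `A` of
minimal weight; only the increase of a pivotal coordinate can increase the minimal weight. -/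
def IsPivotal (A : κ → Finset ι) (x : ι → ℝ) (i : ι) : Prop :=
  ∀ k, ∑ j ∈ A k, x j = ⨅ l, ∑ j ∈ A l, x j → i ∈ A k

lemma measurableSet_isPivotal [Countable κ] (A : κ → Finset ι) (i : ι) :
    MeasurableSet {x : ι → ℝ | IsPivotal A x i} := by
  simp only [IsPivotal, Set.ofPred_forall]
  refine MeasurableSet.iInter fun k => ?_
  by_cases hi : i ∈ A k
  · simp [hi]
  · simp only [hi, imp_false]
    exact (measurableSet_eq_fun (Finset.measurable_sum _ fun j _ => measurable_pi_apply j)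
      (measurable_iInf_sum measurable_pi_apply A)).compl

lemma posPart_iInf_update_sub_le [Finite κ] [Nonempty κ] [DecidableEq ι] (A : κ → Finset ι)
    {x : ι → ℝ} {i : ι} {y : ℝ} (hx : 0 ≤ x i) (hy : 0 ≤ y) :
    max ((⨅ k, ∑ j ∈ A k, Function.update x i y j) - ⨅ k, ∑ j ∈ A k, x j) 0 ≤
      {x | IsPivotal A x i}.indicator (fun _ => y) x := by
  have hle (k : κ) := ciInf_le
    (Set.finite_range fun k => ∑ j ∈ A k, Function.update x i y j).bddBelow k
  by_cases hpiv : IsPivotal A x i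
  · rw [Set.indicator_of_mem (by exact hpiv)]
    obtain ⟨k, hk⟩ := exists_eq_ciInf_of_finite (f := fun k => ∑ j ∈ A k, x j)
    have hmem : i ∈ A k := hpiv k hk
    have hk' := hle k
    rw [Finset.sum_update_of_mem hmem, Finset.sdiff_singleton_eq_erase] at hk'
    have hsum := Finset.add_sum_erase (A k) x hmem
    exact max_le (by linarith) hy
  · rw [Set.indicator_of_notMem (by exact hpiv)]
    simp only [IsPivotal, not_forall] at hpiv
    obtain ⟨k, hk, hmem⟩ := hpiv
    have hk' := hle k
    rw [Finset.sum_update_of_notMem hmem, hk] at hk'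
    exact max_le (by linarith) le_rfl

lemma variance_pi_iInf_sum_le [Fintype ι] [Finite κ] [Nonempty κ] (μ : ι → Measure ℝ)
    [∀ i, IsProbabilityMeasure (μ i)] {K : ℝ} (h0 : ∀ i, ∀ᵐ x ∂μ i, 0 ≤ x)
    (h2 : ∀ i, MemLp id 2 (μ i)) (hK : ∀ i, ∫ x, x ^ 2 ∂μ i ≤ K) (A : κ → Finset ι) :
    Var[fun x : ι → ℝ => ⨅ k, ∑ j ∈ A k, x j; Measure.pi μ] ≤
      K * ∑ i, (Measure.pi μ).real {x | IsPivotal A x i} := by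
  classical
  have h0pi : ∀ᵐ x ∂Measure.pi μ, ∀ i, 0 ≤ x i := ae_all_iff.2 fun i =>
    (measurePreserving_eval μ i).quasiMeasurePreserving.ae (h0 i)
  have hcoord (i : ι) : MemLp (fun x : ι → ℝ => x i) 2 (Measure.pi μ) :=
    (h2 i).comp_measurePreserving (measurePreserving_eval μ i)
  refine (variance_le_sum_integral_sq_posPart μ (memLp_iInf_sum measurable_pi_apply h0pi hcoord A
    (Classical.arbitrary κ))).trans ?_
  rw [Finset.mul_sum]
  refine Finset.sum_le_sum fun i _ => ?_
  have hpiv := measurableSet_isPivotal A i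
  calc _ ≤ ∫ z : (ι → ℝ) × (ι → ℝ), {x | IsPivotal A x i}.indicator (1 : (ι → ℝ) → ℝ) z.1 *
        (z.2 i) ^ 2 ∂((Measure.pi μ).prod (Measure.pi μ)) := by
        refine integral_mono_of_nonneg (Eventually.of_forall fun z => sq_nonneg _)
          (((integrable_const (1 : ℝ)).indicator hpiv).mul_prod (hcoord i).integrable_sq) ?_
        filter_upwards [Measure.quasiMeasurePreserving_fst.ae h0pi,
          Measure.quasiMeasurePreserving_snd.ae h0pi] with z hz hz'
        refine (pow_le_pow_left₀ (le_max_right _ _)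
          (posPart_iInf_update_sub_le A (hz i) (hz' i)) 2).trans_eq ?_
        by_cases hi : IsPivotal A z.1 i <;> simp [hi]
    _ = (Measure.pi μ).real {x | IsPivotal A x i} * ∫ y, y ^ 2 ∂μ i := by
        rw [integral_prod_mul ({x | IsPivotal A x i}.indicator (1 : (ι → ℝ) → ℝ))
          (fun y : ι → ℝ => y i ^ 2), integral_indicator_one hpiv,
          integral_comp_eval (μ := μ) (i := i) (f := fun y => y ^ 2) (by fun_prop)]
    _ ≤ K * (Measure.pi μ).real {x | IsPivotal A x i} := by
        rw [mul_comm]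
        exact mul_le_mul_of_nonneg_right (hK i) measureReal_nonneg

variable {Ω : Type*} [MeasurableSpace Ω] {P : Measure Ω} [IsProbabilityMeasure P]
  {t : ι → Ω → ℝ} {N : Ω → ℝ} {K : ℝ}

lemma sum_measureReal_isPivotal_le [Fintype ι] [Finite κ] [Nonempty κ]
    (ht : ∀ i, Measurable (t i)) (A : κ → Finset ι) (hN : Integrable N P)
    (hA : ∀ᵐ ω ∂P, ∀ k, ∑ i ∈ A k, t i ω = ⨅ l, ∑ i ∈ A l, t i ω → ((A k).card : ℝ) ≤ N ω) :
    ∑ i, P.real {ω | IsPivotal A (t · ω) i} ≤ ∫ ω, N ω ∂P := by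
  classical
  have hms (i : ι) : MeasurableSet {ω | IsPivotal A (t · ω) i} :=
    measurable_pi_lambda _ ht (measurableSet_isPivotal A i)
  have hint (i : ι) : Integrable ({ω | IsPivotal A (t · ω) i}.indicator (1 : Ω → ℝ)) P :=
    (integrable_const (1 : ℝ)).indicator (hms i)
  simp only [← integral_indicator_one (hms _)]
  rw [← integral_finsetSum _ fun i _ => hint i]
  refine integral_mono_ae (integrable_finsetSum _ fun i _ => hint i) hN ?_
  filter_upwards [hA] with ω hω
  obtain ⟨k, hk⟩ := exists_eq_ciInf_of_finite (f := fun k => ∑ i ∈ A k, t i ω)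
  have hsub : Finset.univ.filter (IsPivotal A (t · ω)) ⊆ A k := fun i hi =>
    (Finset.mem_filter.1 hi).2 k hk
  calc ∑ i, {ω | IsPivotal A (t · ω) i}.indicator (1 : Ω → ℝ) ω
      = ((Finset.univ.filter (IsPivotal A (t · ω))).card : ℝ) := by
        simp [Set.indicator_apply]
    _ ≤ (A k).card := by exact_mod_cast Finset.card_le_card hsub
    _ ≤ N ω := hω k hk

lemma variance_iInf_sum_le_of_finite_index [Finite ι] [Finite κ] [Nonempty κ]
    (ht : ∀ i, Measurable (t i)) (hindep : iIndepFun t P) (h0 : ∀ᵐ ω ∂P, ∀ i, 0 ≤ t i ω)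
    (h2 : ∀ i, MemLp (t i) 2 P) (hK : ∀ i, ∫ ω, t i ω ^ 2 ∂P ≤ K) (hK0 : 0 ≤ K)
    (A : κ → Finset ι) (hN : Integrable N P)
    (hA : ∀ᵐ ω ∂P, ∀ k, ∑ i ∈ A k, t i ω = ⨅ l, ∑ i ∈ A l, t i ω → ((A k).card : ℝ) ≤ N ω) :
    Var[fun ω => ⨅ k, ∑ i ∈ A k, t i ω; P] ≤ K * ∫ ω, N ω ∂P := by
  have := Fintype.ofFinite ι
  have hX : Measurable fun ω i => t i ω := measurable_pi_lambda _ ht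
  have (i : ι) : IsProbabilityMeasure (P.map (t i)) :=
    Measure.isProbabilityMeasure_map (ht i).aemeasurable
  have hmap : P.map (fun ω i => t i ω) = Measure.pi fun i => P.map (t i) :=
    (iIndepFun_iff_map_fun_eq_pi_map fun i => (ht i).aemeasurable).1 hindep
  have hvar := variance_pi_iInf_sum_le (fun i => P.map (t i)) (K := K)
    (fun i => (ae_map_iff (ht i).aemeasurable measurableSet_Ici).2 (ae_all_iff.1 h0 i))
    (fun i => (memLp_map_measure_iff aestronglyMeasurable_id (ht i).aemeasurable).2 (h2 i))
    (fun i => by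
      rw [integral_map (ht i).aemeasurable (by fun_prop)]
      exact hK i) A
  rw [← hmap, variance_map (measurable_iInf_sum measurable_pi_apply A).aemeasurable
    hX.aemeasurable] at hvar
  simp only [map_measureReal_apply hX (measurableSet_isPivotal A _)] at hvar
  exact hvar.trans (mul_le_mul_of_nonneg_left (sum_measureReal_isPivotal_le ht A hN hA) hK0)

lemma variance_iInf_sum_le_of_finite [Finite κ] [Nonempty κ] (ht : ∀ i, Measurable (t i))
    (hindep : iIndepFun t P) (h0 : ∀ᵐ ω ∂P, ∀ i, 0 ≤ t i ω) (h2 : ∀ i, MemLp (t i) 2 P)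
    (hK : ∀ i, ∫ ω, t i ω ^ 2 ∂P ≤ K) (hK0 : 0 ≤ K) (A : κ → Finset ι) (hN : Integrable N P)
    (hA : ∀ᵐ ω ∂P, ∀ k, ∑ i ∈ A k, t i ω = ⨅ l, ∑ i ∈ A l, t i ω → ((A k).card : ℝ) ≤ N ω) :
    Var[fun ω => ⨅ k, ∑ i ∈ A k, t i ω; P] ≤ K * ∫ ω, N ω ∂P := by
  classical
  have := Fintype.ofFinite κ
  let F : Finset ι := Finset.univ.biUnion A
  have hF (k : κ) : ∀ i ∈ A k, i ∈ F := fun i hi =>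
    Finset.mem_biUnion.2 ⟨k, Finset.mem_univ k, hi⟩
  have hsum (ω : Ω) (k : κ) : ∑ i ∈ (A k).subtype (· ∈ F), t i ω = ∑ i ∈ A k, t i ω :=
    Finset.sum_subtype_of_mem (t · ω) (hF k)
  have hcard (k : κ) : ((A k).subtype (· ∈ F)).card = (A k).card := by
    rw [Finset.card_subtype, Finset.filter_true_of_mem (hF k)]
  have hvar := variance_iInf_sum_le_of_finite_index (t := fun i : F => t i) (fun i => ht i)
    (hindep.precomp Subtype.val_injective) (h0.mono fun ω hω i => hω i) (fun i => h2 i)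
    (fun i => hK i) hK0 (fun k => (A k).subtype (· ∈ F)) hN
    (by simpa only [hsum, hcard] using hA)
  simpa only [hsum] using hvar

lemma tendsto_iInf_fin {u : ℕ → ℝ} (hu : BddBelow (Set.range u)) :
    Tendsto (fun n : ℕ => ⨅ j : Fin (n + 1), u j) atTop (𝓝 (⨅ j, u j)) := by
  refine tendsto_order.2 ⟨fun a ha => Eventually.of_forall fun n => ha.trans_le ?_, fun a ha => ?_⟩
  · exact le_ciInf fun j => ciInf_le hu _
  · obtain ⟨j, hj⟩ := exists_lt_of_ciInf_lt ha
    filter_upwards [eventually_ge_atTop j] with n hn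
    exact (ciInf_le (Set.finite_range _).bddBelow (⟨j, by omega⟩ : Fin (n + 1))).trans_lt hj

lemma tendsto_variance_of_dominated {X : ℕ → Ω → ℝ} {Y g : Ω → ℝ}
    (hX : ∀ n, AEStronglyMeasurable (X n) P) (hg : MemLp g 2 P)
    (hle : ∀ n, ∀ᵐ ω ∂P, ‖X n ω‖ ≤ g ω)
    (hlim : ∀ᵐ ω ∂P, Tendsto (X · ω) atTop (𝓝 (Y ω))) :
    Tendsto (fun n => Var[X n; P]) atTop (𝓝 Var[Y; P]) := by
  have hXL (n : ℕ) : MemLp (X n) 2 P := hg.mono' (hX n) (hle n)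
  have hYL : MemLp Y 2 P := by
    refine hg.mono' (aestronglyMeasurable_of_tendsto_ae atTop hX hlim) ?_
    filter_upwards [ae_all_iff.2 hle, hlim] with ω hω hlimω
    exact le_of_tendsto' hlimω.norm hω
  rw [variance_eq_sub hYL]
  simp only [fun n => variance_eq_sub (hXL n)]
  refine Tendsto.sub ?_ (Tendsto.pow ?_ 2)
  · refine tendsto_integral_of_dominated_convergence (g · ^ 2) (fun n => (hX n).pow 2)
      hg.integrable_sq (fun n => ?_) (hlim.mono fun ω hω => hω.pow 2)
    filter_upwards [hle n] with ω hω
    simpa only [Pi.pow_apply, norm_pow] using pow_le_pow_left₀ (norm_nonneg _) hω 2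
  · exact tendsto_integral_of_dominated_convergence g hX (hg.integrable one_le_two) hle hlim

theorem variance_iInf_sum_le [Countable κ] (ht : ∀ i, Measurable (t i))
    (hindep : iIndepFun t P) (h0 : ∀ᵐ ω ∂P, ∀ i, 0 ≤ t i ω) (h2 : ∀ i, MemLp (t i) 2 P)
    (hK : ∀ i, ∫ ω, t i ω ^ 2 ∂P ≤ K) (hK0 : 0 ≤ K) (A : κ → Finset ι) (k₀ : κ)
    (hN : Integrable N P)
    (hA : ∀ᵐ ω ∂P, ∀ k, ∑ i ∈ A k, t i ω ≤ ∑ i ∈ A k₀, t i ω → ((A k).card : ℝ) ≤ N ω) :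
    Var[fun ω => ⨅ k, ∑ i ∈ A k, t i ω; P] ≤ K * ∫ ω, N ω ∂P := by
  have : Nonempty κ := ⟨k₀⟩
  obtain ⟨e, he⟩ := exists_surjective_nat κ
  -- Starting the enumeration at `k₀` bounds all the finite minima by the same sum.
  let e' : ℕ → κ := fun n => Nat.casesOn n k₀ e
  have hsurj : Function.Surjective e' := fun k => (he k).imp' Nat.succ fun _ => id
  let T : ℕ → Ω → ℝ := fun n ω => ⨅ j : Fin (n + 1), ∑ i ∈ A (e' j), t i ω
  have hTle (n : ℕ) (ω : Ω) : T n ω ≤ ∑ i ∈ A k₀, t i ω :=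
    ciInf_le (f := fun j : Fin (n + 1) => ∑ i ∈ A (e' j), t i ω) (Set.finite_range _).bddBelow 0
  have hvarlim : Tendsto (fun n => Var[T n; P]) atTop
      (𝓝 (Var[fun ω => ⨅ k, ∑ i ∈ A k, t i ω; P])) := by
    refine tendsto_variance_of_dominated
      (fun n => (measurable_iInf_sum ht fun j : Fin (n + 1) => A (e' j)).aestronglyMeasurable)
      (memLp_finsetSum (A k₀) fun i _ => h2 i) (fun n => ?_) ?_
    all_goals filter_upwards [h0] with ω hω
    all_goals have hsum (k : κ) : 0 ≤ ∑ i ∈ A k, t i ω := Finset.sum_nonneg fun i _ => hω i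
    · rw [Real.norm_of_nonneg (Real.iInf_nonneg fun j => hsum _)]
      exact hTle n ω
    · rw [← hsurj.iInf_comp]
      exact tendsto_iInf_fin ⟨0, Set.forall_mem_range.2 fun n => hsum (e' n)⟩
  refine le_of_tendsto' hvarlim fun n => ?_
  refine variance_iInf_sum_le_of_finite ht hindep h0 h2 hK hK0
    (fun j : Fin (n + 1) => A (e' j)) hN ?_
  filter_upwards [hA] with ω hω j hj
  exact hω _ (hj.le.trans (hTle n ω))

end MinimumOfSums

section WalkEdges

variable {V : Type*} {G : SimpleGraph V} {x y : V}

open Classical in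
/-- The set of edges traversed by a walk, as edges of the graph rather than as unordered pairs of
vertices. -/
noncomputable def walkEdges (w : G.Walk x y) : Finset G.edgeSet :=
  (w.darts.map fun a => (⟨a.edge, a.edge_mem⟩ : G.edgeSet)).toFinset

lemma nodup_darts_map_edge {w : G.Walk x y} (hw : w.IsTrail) :
    (w.darts.map fun a => (⟨a.edge, a.edge_mem⟩ : G.edgeSet)).Nodup := by
  refine List.Nodup.of_map (fun e : G.edgeSet => e.1) ?_
  rw [List.map_map]
  exact hw.edges_nodup

lemma card_walkEdges {w : G.Walk x y} (hw : w.IsTrail) : (walkEdges w).card = w.length := by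
  classical
  rw [walkEdges, List.toFinset_card_of_nodup (nodup_darts_map_edge hw)]
  simp

lemma sum_walkEdges {M : Type*} [AddCommMonoid M] {w : G.Walk x y} (hw : w.IsTrail)
    (f : G.edgeSet → M) :
    ∑ e ∈ walkEdges w, f e = (w.darts.map fun a => f ⟨a.edge, a.edge_mem⟩).sum := by
  classical
  rw [walkEdges, List.sum_toFinset f (nodup_darts_map_edge hw), List.map_map]
  rfl

lemma exists_finset_walkEdges [G.LocallyFinite] {Δ : ℕ} (hΔ : ∀ v, G.degree v ≤ Δ) (k : ℕ)
    (x : V) : ∃ S : Finset (Finset G.edgeSet), S.card ≤ Δ ^ k ∧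
      ∀ (y : V) (w : G.Walk x y), w.length = k → walkEdges w ∈ S := by
  classical
  induction k generalizing x with
  | zero =>
    refine ⟨{∅}, by simp, fun y w hw => ?_⟩
    obtain rfl := w.eq_of_length_eq_zero hw
    simp [SimpleGraph.Walk.length_eq_zero_iff.1 hw, walkEdges]
  | succ k ih =>
    choose S hS hmem using ih
    refine ⟨(G.neighborFinset x).attach.biUnion fun z => (S z).image
      (insert ⟨s(x, z), (G.mem_neighborFinset x z).1 z.2⟩), ?_, fun y w hw => ?_⟩
    · calc _ ≤ ∑ _z ∈ (G.neighborFinset x).attach, Δ ^ k :=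
            Finset.card_biUnion_le.trans
              (Finset.sum_le_sum fun z _ => Finset.card_image_le.trans (hS z))
        _ = G.degree x * Δ ^ k := by simp
        _ ≤ Δ ^ (k + 1) := by
            rw [pow_succ']
            exact Nat.mul_le_mul_right _ (hΔ x)
    · cases w with
      | nil => simp at hw
      | @cons _ z _ h w =>
        refine Finset.mem_biUnion.2 ⟨⟨z, (G.mem_neighborFinset x z).2 h⟩, Finset.mem_attach _ _,
          Finset.mem_image.2 ⟨walkEdges w, hmem z y w (by simpa using hw), ?_⟩⟩
        simp [walkEdges, SimpleGraph.Dart.edge]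

end WalkEdges

section Lattice

variable {d : ℕ} {x y : Fin d → ℤ}

lemma exists_eq_add_single_of_adj (h : (lattice d).Adj x y) :
    ∃ (i : Fin d) (u : ℤˣ), y = x + Pi.single i (u : ℤ) := by
  have hsum : ∑ i, |y i - x i| = 1 := h.symm
  obtain ⟨i, hi⟩ : ∃ i, y i - x i ≠ 0 := by
    by_contra! hzero
    simp [hzero] at hsum
  have hrest : 0 ≤ ∑ j ∈ Finset.univ.erase i, |y j - x j| :=
    Finset.sum_nonneg fun _ _ => abs_nonneg _
  rw [← Finset.add_sum_erase _ _ (Finset.mem_univ i)] at hsum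
  have hone := Int.one_le_abs hi
  obtain ⟨u, hu⟩ := Int.isUnit_iff_abs_eq.2 (by omega : |y i - x i| = 1)
  refine ⟨i, u, funext fun j => ?_⟩
  rcases eq_or_ne j i with rfl | hj
  · simp [hu]
  · have hzero := (Finset.sum_eq_zero_iff_of_nonneg fun _ _ => abs_nonneg _).1
      (by omega : ∑ j ∈ Finset.univ.erase i, |y j - x j| = 0) j
      (Finset.mem_erase.2 ⟨hj, Finset.mem_univ j⟩)
    simpa [hj, sub_eq_zero] using hzero

lemma neighborSet_subset_range (x : Fin d → ℤ) : (lattice d).neighborSet x ⊆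
    Set.range fun p : Fin d × ℤˣ => x + Pi.single p.1 (p.2 : ℤ) := fun _ hy =>
  let ⟨i, u, h⟩ := exists_eq_add_single_of_adj hy
  ⟨(i, u), h.symm⟩

noncomputable instance : (lattice d).LocallyFinite := fun x =>
  ((Set.finite_range _).subset (neighborSet_subset_range x)).fintype

lemma degree_lattice_le (x : Fin d → ℤ) : (lattice d).degree x ≤ 2 * d := by
  rw [← SimpleGraph.card_neighborSet_eq_degree, ← Nat.card_eq_fintype_card]
  calc Nat.card ((lattice d).neighborSet x)
      ≤ Nat.card (Set.range fun p : Fin d × ℤˣ => x + Pi.single p.1 (p.2 : ℤ)) :=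
        Nat.card_mono (Set.finite_range _) (neighborSet_subset_range x)
    _ ≤ Nat.card (Fin d × ℤˣ) := Finite.card_range_le _
    _ = 2 * d := by simp [mul_comm]

lemma abs_sub_le_length (w : (lattice d).Walk x y) (i : Fin d) : |x i - y i| ≤ w.length := by
  induction w with
  | nil => simp
  | @cons x z y h w ih =>
    have hstep : |x i - z i| ≤ 1 :=
      (Finset.single_le_sum (f := fun i => |x i - z i|) (fun _ _ => abs_nonneg _)
        (Finset.mem_univ i)).trans_eq h
    have htri := abs_sub_le (x i) (z i) (y i)
    rw [SimpleGraph.Walk.length_cons]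
    push_cast
    linarith

instance : Countable ((lattice d).Path x y) :=
  Function.Injective.countable (f := fun π : (lattice d).Path x y => π.1.support) fun _ _ h =>
    Subtype.ext (SimpleGraph.Walk.ext_support h)

instance : Countable (Edge d) :=
  have : Countable (Sym2 (Fin d → ℤ)) := inferInstanceAs (Countable (Quot _))
  inferInstanceAs (Countable {e // e ∈ (lattice d).edgeSet})

lemma walkTime_eq_sum (τ : Edge d → ℝ) {w : (lattice d).Walk x y} (hw : w.IsTrail) :
    walkTime τ w = ∑ e ∈ walkEdges w, τ e :=
  (sum_walkEdges hw τ).symm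

lemma walkTime_concat (τ : Edge d → ℝ) {z : Fin d → ℤ} (w : (lattice d).Walk x y)
    (h : (lattice d).Adj y z) : walkTime τ (w.concat h) = walkTime τ w + τ ⟨s(y, z), h⟩ := by
  simp [walkTime, SimpleGraph.Walk.darts_concat, SimpleGraph.Dart.edge]

variable {τ : Edge d → ℝ}

lemma walkTime_nonneg (hτ : ∀ e, 0 ≤ τ e) (w : (lattice d).Walk x y) : 0 ≤ walkTime τ w :=
  List.sum_nonneg (List.forall_mem_map.2 fun _ _ => hτ _)

lemma walkTime_toPath_le (hτ : ∀ e, 0 ≤ τ e) (w : (lattice d).Walk x y) :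
    walkTime τ w.toPath.1 ≤ walkTime τ w :=
  List.Sublist.sum_le_sum (w.darts_bypass_sublist_darts.map _)
    (List.forall_mem_map.2 fun _ _ => hτ _)

end Lattice

section Axis

variable {d : ℕ} [NeZero d]

lemma adj_axisPoint (n : ℕ) : (lattice d).Adj (axisPoint d n) (axisPoint d (n + 1)) := by
  change ∑ i, |axisPoint d n i - axisPoint d (n + 1) i| = 1
  rw [Finset.sum_eq_single 0 (fun i _ hi => by simp [axisPoint, hi]) (by simp)]
  simp [axisPoint]

/-- The edge joining `(n, 0, …, 0)` to `(n + 1, 0, …, 0)`. -/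
def axisEdge (d : ℕ) [NeZero d] (n : ℕ) : Edge d :=
  ⟨s(axisPoint d n, axisPoint d (n + 1)), adj_axisPoint n⟩

lemma exists_walk_walkTime_eq_sum_axisEdge (n : ℕ) :
    ∃ w : (lattice d).Walk 0 (axisPoint d n),
      ∀ τ : Edge d → ℝ, walkTime τ w = ∑ i ∈ Finset.range n, τ (axisEdge d i) := by
  induction n with
  | zero => exact ⟨SimpleGraph.Walk.nil.copy rfl (by simp [axisPoint]), by simp [walkTime]⟩
  | succ n ih =>
    obtain ⟨w, hw⟩ := ih
    exact ⟨w.concat (adj_axisPoint n), fun τ => by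
      rw [walkTime_concat, hw, Finset.sum_range_succ, axisEdge]⟩

instance (n : ℕ) : Nonempty ((lattice d).Path 0 (axisPoint d n)) :=
  ⟨(exists_walk_walkTime_eq_sum_axisEdge n).choose.toPath⟩

lemma le_length_of_walk_axisPoint {n : ℕ} (w : (lattice d).Walk 0 (axisPoint d n)) :
    n ≤ w.length := by
  simpa [axisPoint] using abs_sub_le_length w 0

variable {Ω : Type*} {t : Edge d → Ω → ℝ} {ω : Ω}

lemma minTime_eq_iInf_sum (t : Edge d → Ω → ℝ) (n : ℕ) : minTime t n =
    fun ω => ⨅ π : (lattice d).Path 0 (axisPoint d n), ∑ e ∈ walkEdges π.1, t e ω :=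
  funext fun _ => iInf_congr fun π => walkTime_eq_sum _ π.2.isTrail

lemma minTime_le_walkTime (h0 : ∀ e, 0 ≤ t e ω) {n : ℕ} (w : (lattice d).Walk 0 (axisPoint d n)) :
    minTime t n ω ≤ walkTime (t · ω) w :=
  (ciInf_le ⟨0, Set.forall_mem_range.2 fun _ => walkTime_nonneg h0 _⟩ w.toPath).trans
    (walkTime_toPath_le h0 w)

lemma minTime_le_sum_axisEdge (h0 : ∀ e, 0 ≤ t e ω) (n : ℕ) :
    minTime t n ω ≤ ∑ i ∈ Finset.range n, t (axisEdge d i) ω := by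
  obtain ⟨w, hw⟩ := exists_walk_walkTime_eq_sum_axisEdge (d := d) n
  exact (minTime_le_walkTime h0 w).trans_eq (hw _)

lemma minTime_le_minTime_add_of_adj (h0 : ∀ e, 0 ≤ t e ω) {m n : ℕ}
    (h : (lattice d).Adj (axisPoint d m) (axisPoint d n)) :
    minTime t n ω ≤ minTime t m ω + t ⟨s(axisPoint d m, axisPoint d n), h⟩ ω := by
  rw [← sub_le_iff_le_add]
  refine le_ciInf fun π => ?_
  rw [sub_le_iff_le_add, ← walkTime_concat]
  exact minTime_le_walkTime h0 (π.1.concat h)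

lemma abs_minTime_succ_sub_le (h0 : ∀ e, 0 ≤ t e ω) (n : ℕ) :
    |minTime t (n + 1) ω - minTime t n ω| ≤ t (axisEdge d n) ω := by
  have hright := minTime_le_minTime_add_of_adj h0 (adj_axisPoint (d := d) n)
  have hleft := minTime_le_minTime_add_of_adj h0 (adj_axisPoint (d := d) n).symm
  simp only [Sym2.eq_swap (a := axisPoint d (n + 1))] at hleft
  exact abs_sub_le_iff.2 ⟨sub_le_iff_le_add'.2 hright, sub_le_iff_le_add'.2 hleft⟩

variable [MeasurableSpace Ω] {P : Measure Ω}

lemma measurable_minTime (ht : ∀ e, Measurable (t e)) (n : ℕ) : Measurable (minTime t n) := by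
  rw [minTime_eq_iInf_sum]
  exact measurable_iInf_sum ht _

lemma memLp_minTime (ht : ∀ e, Measurable (t e)) (h0 : ∀ᵐ ω ∂P, ∀ e, 0 ≤ t e ω) {p : ℝ≥0∞}
    (hp : ∀ e, MemLp (t e) p P) (n : ℕ) : MemLp (minTime t n) p P := by
  rw [minTime_eq_iInf_sum]
  exact memLp_iInf_sum ht h0 hp _ (Classical.arbitrary _)

end Axis

section LargeDeviations

variable {Ω : Type*} [MeasurableSpace Ω] {P : Measure Ω} [IsProbabilityMeasure P]

lemma mgf_neg_le_measureReal_add_exp {X : Ω → ℝ} (hX : Measurable X) (h0 : ∀ᵐ ω ∂P, 0 ≤ X ω)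
    {s : ℝ} (hs : 0 ≤ s) (ε : ℝ) :
    mgf X P (-s) ≤ P.real {ω | X ω < ε} + Real.exp (-s * ε) := by
  have hms : MeasurableSet {ω | X ω < ε} := measurableSet_lt hX measurable_const
  have hint : Integrable ({ω | X ω < ε}.indicator (1 : Ω → ℝ)) P :=
    (integrable_const (1 : ℝ)).indicator hms
  calc mgf X P (-s)
      ≤ ∫ ω, ({ω | X ω < ε}.indicator (1 : Ω → ℝ) ω + Real.exp (-s * ε)) ∂P := by
        refine integral_mono_of_nonneg (Eventually.of_forall fun ω => (Real.exp_pos _).le)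
          (hint.add (integrable_const _)) ?_
        filter_upwards [h0] with ω hω
        by_cases h : X ω < ε
        · rw [Set.indicator_of_mem (by exact h), Pi.one_apply]
          have hexp : Real.exp (-s * X ω) ≤ 1 := Real.exp_le_one_iff.2 (by nlinarith)
          linarith [Real.exp_pos (-s * ε)]
        · rw [Set.indicator_of_notMem (by exact h), zero_add]
          exact Real.exp_le_exp.2 (by nlinarith [not_lt.1 h])
    _ = P.real {ω | X ω < ε} + Real.exp (-s * ε) := by
        rw [integral_add hint (integrable_const _), integral_indicator_one hms]
        simp

section Chernoff

variable {ι : Type*} {t : ι → Ω → ℝ}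

lemma measureReal_sum_le_le_pow (ht : ∀ i, Measurable (t i)) (hindep : iIndepFun t P)
    (h0 : ∀ i, ∀ᵐ ω ∂P, 0 ≤ t i ω) {s δ : ℝ} (hs : 0 ≤ s) (hδ : ∀ i, mgf (t i) P (-s) ≤ δ)
    (a : ℝ) (A : Finset ι) :
    P.real {ω | ∑ i ∈ A, t i ω ≤ a * A.card} ≤ (Real.exp (s * a) * δ) ^ A.card := by
  have hint : Integrable (fun ω => Real.exp (-s * (∑ i ∈ A, t i) ω)) P := by
    refine Integrable.of_bound (C := 1) (by fun_prop) ?_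
    filter_upwards [(ae_ball_iff A.countable_toSet).2 fun i _ => h0 i] with ω hω
    rw [Real.norm_of_nonneg (Real.exp_pos _).le, Finset.sum_apply]
    exact Real.exp_le_one_iff.2
      (mul_nonpos_of_nonpos_of_nonneg (neg_nonpos.2 hs) (Finset.sum_nonneg hω))
  have hchernoff := measure_le_le_exp_mul_mgf (a * A.card) (neg_nonpos.2 hs) hint
  rw [hindep.mgf_sum ht] at hchernoff
  simp only [Finset.sum_apply] at hchernoff
  calc _ ≤ _ := hchernoff
    _ ≤ Real.exp (A.card * (s * a)) * δ ^ A.card := by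
        rw [neg_neg, mul_comm a, mul_left_comm, ← Finset.prod_const]
        exact mul_le_mul_of_nonneg_left
          (Finset.prod_le_prod (fun i _ => mgf_nonneg) fun i _ => hδ i) (Real.exp_pos _).le
    _ = (Real.exp (s * a) * δ) ^ A.card := by rw [Real.exp_nat_mul, mul_pow]

lemma exists_measureReal_sum_le_le_pow (ht : ∀ i, Measurable (t i)) (hindep : iIndepFun t P)
    (h0 : ∀ i, ∀ᵐ ω ∂P, 0 ≤ t i ω) {ε p r : ℝ} (hε : 0 < ε) (hp0 : 0 ≤ p)
    (hp : ∀ i, P.real {ω | t i ω < ε} ≤ p) (hpr : p < r) :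
    ∃ a : ℝ, 0 < a ∧ ∀ A : Finset ι, P.real {ω | ∑ i ∈ A, t i ω ≤ a * A.card} ≤ r ^ A.card := by
  have hlarge : Tendsto (fun s : ℝ => p + Real.exp (-s * ε)) atTop (𝓝 p) := by
    simpa using (Real.tendsto_exp_atBot.comp
      (tendsto_neg_atTop_atBot.atBot_mul_const hε)).const_add p
  obtain ⟨s, hs, hs0⟩ := ((hlarge.eventually_lt_const hpr).and (eventually_ge_atTop 0)).exists
  have hsmall : Tendsto (fun a : ℝ => Real.exp (s * a) * (p + Real.exp (-s * ε))) (𝓝[>] 0)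
      (𝓝 (p + Real.exp (-s * ε))) :=
    tendsto_nhdsWithin_of_tendsto_nhds (Continuous.tendsto' (by fun_prop) _ _ (by simp))
  obtain ⟨a, har, ha⟩ := ((hsmall.eventually_lt_const hs).and self_mem_nhdsWithin).exists
  refine ⟨a, ha, fun A => (measureReal_sum_le_le_pow ht hindep h0 hs0 (fun i =>
    (mgf_neg_le_measureReal_add_exp (ht i) (h0 i) hs0 ε).trans (by gcongr; exact hp i)) a A).trans
    (pow_le_pow_left₀ (by positivity) har.le _)⟩

end Chernoff

lemma exists_integrable_natCast_le_of_mem {E : ℕ → Set Ω} (hE : ∀ k, MeasurableSet (E k)) {q : ℝ}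
    (hq0 : 0 ≤ q) (hq1 : q < 1) (hP : ∀ k, P.real (E k) ≤ q ^ k) :
    ∃ R : Ω → ℝ, Integrable R P ∧ (∀ ω, 0 ≤ R ω) ∧ ∀ᵐ ω ∂P, ∀ k, ω ∈ E k → (k : ℝ) ≤ R ω := by
  let S : Ω → ℝ≥0∞ := fun ω => ∑' k : ℕ, (E k).indicator (fun _ => (k : ℝ≥0∞)) ω
  have hS : Measurable S := Measurable.tsum fun k => measurable_const.indicator (hE k)
  have hfin : ∫⁻ ω, S ω ∂P ≠ ∞ := by
    have hsum : Summable fun k : ℕ => (k : ℝ) ^ 1 * q ^ k :=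
      summable_pow_mul_geometric_of_norm_lt_one 1 (by rwa [Real.norm_of_nonneg hq0])
    refine ne_top_of_le_ne_top hsum.tsum_ofReal_ne_top ?_
    rw [lintegral_tsum fun k => (measurable_const.indicator (hE k)).aemeasurable]
    refine ENNReal.tsum_le_tsum fun k => ?_
    rw [lintegral_indicator_const (hE k), pow_one, ENNReal.ofReal_mul (by positivity),
      ENNReal.ofReal_natCast]
    gcongr
    exact (ENNReal.le_ofReal_iff_toReal_le (measure_ne_top _ _) (by positivity)).2 (hP k)
  refine ⟨fun ω => (S ω).toReal, integrable_toReal_of_lintegral_ne_top hS.aemeasurable hfin,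
    fun ω => ENNReal.toReal_nonneg, ?_⟩
  filter_upwards [ae_lt_top hS hfin] with ω hω k hk
  have hle : (k : ℝ≥0∞) ≤ S ω := by
    simpa [Set.indicator_of_mem hk] using
      ENNReal.le_tsum (f := fun k => (E k).indicator (fun _ => (k : ℝ≥0∞)) ω) k
  simpa using ENNReal.toReal_mono hω.ne hle

section ShortestPaths

variable {d : ℕ} {t : Edge d → Ω → ℝ}

/-- The event that some self-avoiding path of length `k` from the origin has passage time at most
`a k`. -/
def fastPathEvent (t : Edge d → Ω → ℝ) (a : ℝ) (k : ℕ) : Set Ω :=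
  ⋃ (y : Fin d → ℤ) (π : (lattice d).Path 0 y) (_ : π.1.length = k),
    {ω | walkTime (t · ω) π.1 ≤ a * k}

lemma measurableSet_fastPathEvent (ht : ∀ e, Measurable (t e)) (a : ℝ) (k : ℕ) :
    MeasurableSet (fastPathEvent t a k) := by
  refine .iUnion fun y => .iUnion fun π => .iUnion fun _ => ?_
  simp only [walkTime_eq_sum _ π.2.isTrail]
  exact measurableSet_le (Finset.measurable_sum _ fun e _ => ht e) measurable_const

lemma measureReal_fastPathEvent_le {a r : ℝ} (hr : 0 ≤ r)
    (hP : ∀ A : Finset (Edge d), P.real {ω | ∑ e ∈ A, t e ω ≤ a * A.card} ≤ r ^ A.card) (k : ℕ) :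
    P.real (fastPathEvent t a k) ≤ (2 * d * r) ^ k := by
  classical
  obtain ⟨S, hS, hmem⟩ := exists_finset_walkEdges (degree_lattice_le (d := d)) k 0
  let S' := S.filter fun A => A.card = k
  have hsub : fastPathEvent t a k ⊆ ⋃ A ∈ S', {ω | ∑ e ∈ A, t e ω ≤ a * A.card} := by
    intro ω hω
    simp only [fastPathEvent, Set.mem_iUnion] at hω
    obtain ⟨y, π, hk, hω⟩ := hω
    have hcard : (walkEdges π.1).card = k := (card_walkEdges π.2.isTrail).trans hk
    refine Set.mem_biUnion (Finset.mem_filter.2 ⟨hmem y π.1 hk, hcard⟩) ?_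
    rwa [Set.mem_ofPred_eq, hcard, ← walkTime_eq_sum (t · ω) π.2.isTrail]
  calc P.real (fastPathEvent t a k)
      ≤ ∑ A ∈ S', P.real {ω | ∑ e ∈ A, t e ω ≤ a * A.card} :=
        (measureReal_mono hsub (measure_ne_top _ _)).trans (measureReal_biUnion_finset_le _ _)
    _ ≤ ∑ _A ∈ S', r ^ k :=
        Finset.sum_le_sum fun A hA => (hP A).trans_eq (by rw [(Finset.mem_filter.1 hA).2])
    _ = S'.card * r ^ k := by rw [Finset.sum_const, nsmul_eq_mul]
    _ ≤ (2 * d) ^ k * r ^ k := by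
        gcongr
        exact_mod_cast (Finset.card_filter_le _ _).trans hS
    _ = (2 * d * r) ^ k := (mul_pow _ _ _).symm

theorem exists_mul_length_le_walkTime_add [NeZero d] (ht : ∀ e, Measurable (t e))
    (hindep : iIndepFun t P) (h0 : ∀ᵐ ω ∂P, ∀ e, 0 ≤ t e ω) {ε : ℝ} (hε : 0 < ε)
    (hlt : ⨆ e, P {ω | t e ω < ε} < (2 * d : ℝ≥0∞)⁻¹) :
    ∃ (a : ℝ) (R : Ω → ℝ), 0 < a ∧ Integrable R P ∧ ∀ᵐ ω ∂P, ∀ (y : Fin d → ℤ)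
      (π : (lattice d).Path 0 y), a * π.1.length ≤ walkTime (t · ω) π.1 + R ω := by
  have hd : (0 : ℝ) < 2 * d := by exact_mod_cast Nat.mul_pos two_pos (NeZero.pos d)
  obtain ⟨r, hpr, hr⟩ := exists_between (show (⨆ e, P {ω | t e ω < ε}).toReal < (2 * d : ℝ)⁻¹ by
    simpa using ENNReal.toReal_strict_mono (by simp [NeZero.ne d]) hlt)
  have hr0 : 0 ≤ r := ENNReal.toReal_nonneg.trans hpr.le
  obtain ⟨a, ha, hP⟩ := exists_measureReal_sum_le_le_pow ht hindep (ae_all_iff.1 h0) hε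
    ENNReal.toReal_nonneg (fun e => ENNReal.toReal_mono hlt.ne_top
      (le_iSup (fun e => P {ω | t e ω < ε}) e)) hpr
  obtain ⟨R, hR, hR0, hmem⟩ := exists_integrable_natCast_le_of_mem
    (measurableSet_fastPathEvent ht a) (by positivity)
    ((lt_inv_mul_iff₀ hd).1 (by simpa using hr)) (measureReal_fastPathEvent_le hr0 hP)
  refine ⟨a, fun ω => a * R ω, ha, hR.const_mul a, ?_⟩
  filter_upwards [h0, hmem] with ω hω hmemω y π
  by_cases hfast : walkTime (t · ω) π.1 ≤ a * π.1.length
  · have hlen := hmemω π.1.length (by simpa only [fastPathEvent, Set.mem_iUnion] using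
      ⟨y, π, rfl, hfast⟩)
    linarith [mul_le_mul_of_nonneg_left hlen ha.le, walkTime_nonneg hω π.1]
  · linarith [mul_nonneg ha.le (hR0 ω)]

end ShortestPaths

end LargeDeviations

section SecondMoments

lemma tendsto_div_of_tendsto_div_sq {y : ℕ → ℝ}
    (hsq : Tendsto (fun k : ℕ => y (k ^ 2) / (k : ℝ) ^ 2) atTop (𝓝 0))
    (hgap : Tendsto (fun k : ℕ => (∑ i ∈ Finset.Ico (k ^ 2) ((k + 1) ^ 2), |y (i + 1) - y i|) /
      (k : ℝ) ^ 2) atTop (𝓝 0)) : Tendsto (fun n : ℕ => y n / n) atTop (𝓝 0) := by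
  have hsqrt : Tendsto Nat.sqrt atTop atTop :=
    tendsto_atTop_atTop.2 fun b => ⟨b ^ 2, fun n hn => Nat.le_sqrt'.2 hn⟩
  have hlim := (hsq.abs.add hgap).comp hsqrt
  rw [abs_zero, add_zero] at hlim
  refine squeeze_zero_norm' ?_ hlim
  filter_upwards [eventually_ge_atTop 1] with n hn
  set k := Nat.sqrt n
  have hk : (0 : ℝ) < k := by exact_mod_cast Nat.sqrt_pos.2 hn
  have hkn : k ^ 2 ≤ n := Nat.sqrt_le' n
  have hgap_le : |y n - y (k ^ 2)| ≤ ∑ i ∈ Finset.Ico (k ^ 2) ((k + 1) ^ 2), |y (i + 1) - y i| :=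
    calc |y n - y (k ^ 2)| ≤ ∑ i ∈ Finset.Ico (k ^ 2) n, |y (i + 1) - y i| := by
          simpa only [Real.dist_eq, abs_sub_comm] using dist_le_Ico_sum_dist y hkn
      _ ≤ _ := Finset.sum_le_sum_of_subset_of_nonneg
          (Finset.Ico_subset_Ico_right (Nat.lt_succ_sqrt' n).le) fun _ _ _ => abs_nonneg _
  calc ‖y n / n‖ = |y n| / n := by rw [Real.norm_eq_abs, abs_div, Nat.abs_cast]
    _ ≤ |y n| / (k : ℝ) ^ 2 := by
        gcongr
        exact_mod_cast hkn
    _ ≤ (|y (k ^ 2)| + ∑ i ∈ Finset.Ico (k ^ 2) ((k + 1) ^ 2), |y (i + 1) - y i|) /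
          (k : ℝ) ^ 2 := by
        gcongr
        linarith [abs_sub_abs_le_abs_sub (y n) (y (k ^ 2))]
    _ = _ := by
        rw [Function.comp_apply, add_div, abs_div, abs_of_pos (pow_pos hk 2)]

variable {Ω : Type*} [MeasurableSpace Ω] {P : Measure Ω}

lemma ae_tendsto_zero_of_summable_integral_sq {X : ℕ → Ω → ℝ} (hX : ∀ k, MemLp (X k) 2 P)
    (hsum : Summable fun k => ∫ ω, X k ω ^ 2 ∂P) :
    ∀ᵐ ω ∂P, Tendsto (fun k => X k ω) atTop (𝓝 0) := by
  have hm (k : ℕ) : AEMeasurable (fun ω => ENNReal.ofReal (X k ω ^ 2)) P :=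
    ((hX k).1.aemeasurable.pow_const 2).ennreal_ofReal
  have hfin : ∫⁻ ω, ∑' k, ENNReal.ofReal (X k ω ^ 2) ∂P ≠ ∞ := by
    rw [lintegral_tsum hm]
    simp only [fun k => (ofReal_integral_eq_lintegral_ofReal (hX k).integrable_sq
      (Eventually.of_forall fun _ => sq_nonneg _)).symm]
    exact hsum.tsum_ofReal_ne_top
  filter_upwards [ae_lt_top' (AEMeasurable.tsum hm) hfin] with ω hω
  have hsq : Tendsto (fun k => X k ω ^ 2) atTop (𝓝 0) := by
    simpa only [Function.comp_def, ENNReal.toReal_ofReal (sq_nonneg _), ENNReal.toReal_zero] using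
      (ENNReal.tendsto_toReal ENNReal.zero_ne_top).comp
        (ENNReal.tendsto_atTop_zero_of_tsum_ne_top hω.ne)
  refine (tendsto_zero_iff_abs_tendsto_zero _).2 ?_
  simpa only [Function.comp_def, Real.sqrt_sq_eq_abs, Real.sqrt_zero] using hsq.sqrt

lemma ae_tendsto_div_sq_of_integral_sq_le {U : ℕ → Ω → ℝ} {c : ℝ} (hU : ∀ k, MemLp (U k) 2 P)
    (hc : ∀ k : ℕ, 1 ≤ k → ∫ ω, U k ω ^ 2 ∂P ≤ c * (k : ℝ) ^ 2) :
    ∀ᵐ ω ∂P, Tendsto (fun k : ℕ => U k ω / (k : ℝ) ^ 2) atTop (𝓝 0) := by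
  refine ae_tendsto_zero_of_summable_integral_sq (X := fun k ω => U k ω / (k : ℝ) ^ 2)
    (fun k => by simpa only [div_eq_mul_inv] using (hU k).mul_const _) ?_
  refine Summable.of_nonneg_of_le (fun k => integral_nonneg fun ω => sq_nonneg _) (fun k => ?_)
    ((Real.summable_nat_pow_inv.2 one_lt_two).mul_left c)
  simp only [div_pow, integral_div]
  rcases k.eq_zero_or_pos with rfl | hk
  · simp
  · have hk0 : (k : ℝ) ≠ 0 := Nat.cast_ne_zero.2 hk.ne'
    rw [div_le_iff₀ (by positivity)]
    exact (hc k hk).trans_eq (by field_simp)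

lemma tendsto_eLpNorm_two_of_integral_sq {X : ℕ → Ω → ℝ} (hX : ∀ k, MemLp (X k) 2 P)
    (h : Tendsto (fun k => ∫ ω, X k ω ^ 2 ∂P) atTop (𝓝 0)) :
    Tendsto (fun k => eLpNorm (X k) 2 P) atTop (𝓝 0) := by
  have hroot : Tendsto (fun k => (∫ ω, X k ω ^ 2 ∂P) ^ (2 : ℝ)⁻¹) atTop (𝓝 0) := by
    simpa using h.rpow_const (p := (2 : ℝ)⁻¹) (Or.inr (by norm_num))
  simpa [(hX _).eLpNorm_eq_integral_rpow_norm two_ne_zero ENNReal.ofNat_ne_top] using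
    ENNReal.tendsto_ofReal hroot

lemma integral_sq_sum_le {ι : Type*} {X : ι → Ω → ℝ} (hX : ∀ i, MemLp (X i) 2 P) {K : ℝ}
    (hK : ∀ i, ∫ ω, X i ω ^ 2 ∂P ≤ K) (s : Finset ι) :
    ∫ ω, (∑ i ∈ s, X i ω) ^ 2 ∂P ≤ (s.card : ℝ) ^ 2 * K := by
  calc ∫ ω, (∑ i ∈ s, X i ω) ^ 2 ∂P ≤ ∫ ω, s.card * ∑ i ∈ s, X i ω ^ 2 ∂P :=
        integral_mono (memLp_finsetSum s fun i _ => hX i).integrable_sq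
          ((integrable_finsetSum s fun i _ => (hX i).integrable_sq).const_mul _)
          fun ω => sq_sum_le_card_mul_sum_sq
    _ = s.card * ∑ i ∈ s, ∫ ω, X i ω ^ 2 ∂P := by
        rw [integral_const_mul, integral_finsetSum s fun i _ => (hX i).integrable_sq]
    _ ≤ s.card * (s.card * K) := by
        gcongr
        exact (Finset.sum_le_card_nsmul s _ K fun i _ => hK i).trans_eq (nsmul_eq_mul _ _)
    _ = (s.card : ℝ) ^ 2 * K := by ring

theorem ae_tendsto_div_of_integral_sq_le {Y : ℕ → Ω → ℝ} {C K : ℝ} (hY : ∀ n, MemLp (Y n) 2 P)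
    (hC : ∀ n : ℕ, 1 ≤ n → ∫ ω, Y n ω ^ 2 ∂P ≤ C * n)
    (hK : ∀ n, ∫ ω, (Y (n + 1) ω - Y n ω) ^ 2 ∂P ≤ K) :
    ∀ᵐ ω ∂P, Tendsto (fun n : ℕ => Y n ω / n) atTop (𝓝 0) := by
  let gap (k : ℕ) (ω : Ω) : ℝ :=
    ∑ i ∈ Finset.Ico (k ^ 2) ((k + 1) ^ 2), |Y (i + 1) ω - Y i ω|
  have hstep (i : ℕ) : MemLp (fun ω => |Y (i + 1) ω - Y i ω|) 2 P := ((hY _).sub (hY i)).abs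
  have hgap (k : ℕ) : MemLp (gap k) 2 P := memLp_finsetSum _ fun i _ => hstep i
  have hK0 : 0 ≤ K := (integral_nonneg fun ω => sq_nonneg _).trans (hK 0)
  have hgap_sq (k : ℕ) (hk : 1 ≤ k) : ∫ ω, gap k ω ^ 2 ∂P ≤ 9 * K * (k : ℝ) ^ 2 := by
    refine (integral_sq_sum_le hstep (by simpa only [sq_abs] using hK) _).trans ?_
    have hcard : (Finset.Ico (k ^ 2) ((k + 1) ^ 2)).card ≤ 3 * k := by
      rw [Nat.card_Ico]
      exact Nat.sub_le_iff_le_add.2 (by nlinarith)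
    calc _ ≤ (3 * k : ℝ) ^ 2 * K := by
          gcongr
          exact_mod_cast hcard
      _ = 9 * K * (k : ℝ) ^ 2 := by ring
  filter_upwards [
    ae_tendsto_div_sq_of_integral_sq_le (fun k => hY (k ^ 2)) (c := C)
      fun k hk => by simpa using hC (k ^ 2) (Nat.one_le_pow _ _ hk),
    ae_tendsto_div_sq_of_integral_sq_le hgap hgap_sq] with ω hsq hgapω
  exact tendsto_div_of_tendsto_div_sq hsq hgapω

end SecondMoments

section Growth

lemma le_liminf_div_of_mul_sub_le {u : ℕ → ℝ} {a b : ℝ} (h : ∀ n : ℕ, a * n - b ≤ u n) :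
    (a : EReal) ≤ liminf (fun n : ℕ => ((u n / n : ℝ) : EReal)) atTop := by
  have hlim : Tendsto (fun n : ℕ => ((a - b / n : ℝ) : EReal)) atTop (𝓝 (a : EReal)) :=
    (continuous_coe_real_ereal.tendsto a).comp
      (by simpa using (tendsto_const_div_atTop_nhds_zero_nat b).const_sub a)
  rw [← hlim.liminf_eq]
  refine liminf_le_liminf ?_
  filter_upwards [eventually_ge_atTop 1] with n hn
  have hn0 : (0 : ℝ) < n := by exact_mod_cast hn
  rw [EReal.coe_le_coe_iff, le_div_iff₀ hn0, sub_mul, div_mul_cancel₀ _ hn0.ne']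
  exact h n

lemma limsup_div_le_of_le_mul {u m : ℕ → ℝ} {c : ℝ}
    (hu : Tendsto (fun n : ℕ => (u n - m n) / n) atTop (𝓝 0)) (hm : ∀ n : ℕ, m n ≤ c * n) :
    limsup (fun n : ℕ => ((u n / n : ℝ) : EReal)) atTop ≤ c := by
  have hlim : Tendsto (fun n : ℕ => (((u n - m n) / n + c : ℝ) : EReal)) atTop (𝓝 (c : EReal)) :=
    (continuous_coe_real_ereal.tendsto c).comp (by simpa using hu.add_const c)
  rw [← hlim.limsup_eq]
  refine limsup_le_limsup ?_
  filter_upwards [eventually_ge_atTop 1] with n hn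
  have hn0 : (0 : ℝ) < n := by exact_mod_cast hn
  rw [EReal.coe_le_coe_iff, div_add' _ _ _ hn0.ne']
  gcongr
  linarith [hm n]

end Growth

section Conditions

variable {d : ℕ} {Ω : Type*} [MeasurableSpace Ω] {P : Measure Ω} {t : Edge d → Ω → ℝ}

lemma NoMassNearZero.ae_nonneg (hi : NoMassNearZero P t) : ∀ᵐ ω ∂P, ∀ e, 0 ≤ t e ω := by
  refine ae_all_iff.2 fun e => ?_
  have hle : P {ω | t e ω < 0} ≤ 0 := by
    refine ge_of_tendsto hi ?_
    filter_upwards [self_mem_nhdsWithin] with ε (hε : 0 < ε)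
    exact (measure_mono fun ω (hω : t e ω < 0) => hω.trans hε).trans
      (le_iSup (fun e => P {ω | t e ω < ε}) e)
  rw [ae_iff]
  simpa only [not_le] using nonpos_iff_eq_zero.1 hle

lemma NoMassNearZero.exists_iSup_measure_lt (hi : NoMassNearZero P t) {c : ℝ≥0∞} (hc : 0 < c) :
    ∃ ε : ℝ, 0 < ε ∧ ⨆ e, P {ω | t e ω < ε} < c :=
  let ⟨ε, hlt, hε⟩ := ((hi.eventually_lt_const hc).and self_mem_nhdsWithin).exists
  ⟨ε, hε, hlt⟩

lemma BoundedSecondMoments.memLp (h : BoundedSecondMoments P t) (ht : ∀ e, Measurable (t e))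
    (e : Edge d) : MemLp (t e) 2 P := by
  rw [memLp_two_iff_integrable_sq (ht e).aestronglyMeasurable]
  refine ⟨((ht e).pow_const 2).aestronglyMeasurable, ?_⟩
  rw [hasFiniteIntegral_iff_ofReal (Eventually.of_forall fun ω => sq_nonneg _)]
  exact (le_iSup (fun e => ∫⁻ ω, ENNReal.ofReal (t e ω ^ 2) ∂P) e).trans_lt h

lemma BoundedSecondMoments.exists_integral_sq_le (h : BoundedSecondMoments P t)
    (ht : ∀ e, Measurable (t e)) : ∃ K : ℝ, ∀ e, ∫ ω, t e ω ^ 2 ∂P ≤ K := by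
  refine ⟨(⨆ e, ∫⁻ ω, ENNReal.ofReal (t e ω ^ 2) ∂P).toReal, fun e => ?_⟩
  rw [integral_eq_lintegral_of_nonneg_ae (Eventually.of_forall fun ω => sq_nonneg _)
    ((ht e).pow_const 2).aestronglyMeasurable]
  exact ENNReal.toReal_mono h.ne (le_iSup (fun e => ∫⁻ ω, ENNReal.ofReal (t e ω ^ 2) ∂P) e)

variable [IsProbabilityMeasure P]

lemma UnifIntegrableSquares.boundedSecondMoments (h : UnifIntegrableSquares P t)
    (ht : ∀ e, Measurable (t e)) (h0 : ∀ᵐ ω ∂P, ∀ e, 0 ≤ t e ω) : BoundedSecondMoments P t := by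
  obtain ⟨M, hM⟩ := (h.eventually_lt_const zero_lt_one).exists
  refine (iSup_le fun e => ?_).trans_lt
    (ENNReal.add_lt_top.2 ⟨ENNReal.one_lt_top, ENNReal.ofReal_lt_top (r := M ^ 2)⟩)
  have hms : MeasurableSet {ω | M ≤ t e ω} := measurableSet_le measurable_const (ht e)
  rw [← lintegral_add_compl _ hms]
  gcongr
  · exact (le_iSup (fun e => ∫⁻ ω in {ω | M ≤ t e ω}, ENNReal.ofReal (t e ω ^ 2) ∂P) e).trans hM.le
  · calc ∫⁻ ω in {ω | M ≤ t e ω}ᶜ, ENNReal.ofReal (t e ω ^ 2) ∂P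
        ≤ ∫⁻ ω in {ω | M ≤ t e ω}ᶜ, ENNReal.ofReal (M ^ 2) ∂P := by
          refine lintegral_mono_ae ?_
          filter_upwards [ae_restrict_of_ae h0, ae_restrict_mem hms.compl]
            with ω hω (hlt : ¬M ≤ t e ω)
          exact ENNReal.ofReal_le_ofReal (pow_le_pow_left₀ (hω e) (not_le.1 hlt).le 2)
      _ ≤ ENNReal.ofReal (M ^ 2) := by
          rw [setLIntegral_const]
          exact mul_le_of_le_one_right zero_le prob_le_one

lemma BoundedHigherMoments.boundedSecondMoments (h : BoundedHigherMoments P t)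
    (h0 : ∀ᵐ ω ∂P, ∀ e, 0 ≤ t e ω) : BoundedSecondMoments P t := by
  obtain ⟨p, hp, h⟩ := h
  refine (iSup_le fun e => ?_).trans_lt (ENNReal.add_lt_top.2 ⟨ENNReal.one_lt_top, h⟩)
  calc ∫⁻ ω, ENNReal.ofReal (t e ω ^ 2) ∂P
      ≤ ∫⁻ ω, (1 + ENNReal.ofReal (t e ω ^ p)) ∂P := by
        refine lintegral_mono_ae (h0.mono fun ω hω => ?_)
        rw [← ENNReal.ofReal_one, ← ENNReal.ofReal_add zero_le_one (Real.rpow_nonneg (hω e) p)]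
        refine ENNReal.ofReal_le_ofReal ?_
        rcases le_total (t e ω) 1 with hle | hge
        · linarith [pow_le_one₀ (n := 2) (hω e) hle, Real.rpow_nonneg (hω e) p]
        · have hpow := Real.rpow_le_rpow_of_exponent_le hge hp.le
          rw [Real.rpow_two] at hpow
          linarith
    _ = 1 + ∫⁻ ω, ENNReal.ofReal (t e ω ^ p) ∂P := by
        rw [lintegral_add_left measurable_const, lintegral_const, measure_univ, mul_one]
    _ ≤ _ := by
        gcongr
        exact le_iSup (fun e => ∫⁻ ω, ENNReal.ofReal (t e ω ^ p) ∂P) e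

variable [NeZero d]

lemma memLp_centredTime {q : ℝ≥0∞} {n : ℕ} (h : MemLp (minTime t n) q P) :
    MemLp (centredTime P t n) q P := by
  have hmul : centredTime P t n = fun ω => (n : ℝ)⁻¹ * (minTime t n ω - ∫ ω, minTime t n ω ∂P) :=
    funext fun ω => div_eq_inv_mul _ _
  rw [hmul]
  exact (h.sub (memLp_const _)).const_mul _

lemma ConvergesInLp.mono_exponent {p q : ℝ≥0∞} (h : ConvergesInLp q P t)
    (hpq : p ≤ q) : ConvergesInLp p P t :=
  ⟨fun n => (h.1 n).mono_exponent hpq,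
    tendsto_of_tendsto_of_tendsto_of_le_of_le tendsto_const_nhds h.2 (fun _ => zero_le)
      fun n => eLpNorm_le_eLpNorm_of_exponent_le hpq (memLp_centredTime (h.1 n)).1⟩

end Conditions

section FirstPassage

variable {Ω : Type*} [MeasurableSpace Ω] {P : Measure Ω} [IsProbabilityMeasure P] {K : ℝ}

lemma integral_le_one_add_of_integral_sq_le {X : Ω → ℝ} (hX : MemLp X 2 P)
    (hK : ∫ ω, X ω ^ 2 ∂P ≤ K) : ∫ ω, X ω ∂P ≤ 1 + K := by
  calc ∫ ω, X ω ∂P ≤ ∫ ω, (1 + X ω ^ 2) ∂P :=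
        integral_mono (hX.integrable one_le_two) ((integrable_const 1).add hX.integrable_sq)
          fun ω => by nlinarith [sq_nonneg (X ω - 1)]
    _ = 1 + ∫ ω, X ω ^ 2 ∂P := by
        rw [integral_add (integrable_const 1) hX.integrable_sq, integral_const, probReal_univ,
          one_smul]
    _ ≤ 1 + K := by linarith

variable {d : ℕ} [NeZero d] {t : Edge d → Ω → ℝ}

lemma integral_sum_axisEdge_le (h2 : ∀ e, MemLp (t e) 2 P) (hK : ∀ e, ∫ ω, t e ω ^ 2 ∂P ≤ K)
    (n : ℕ) : ∫ ω, ∑ i ∈ Finset.range n, t (axisEdge d i) ω ∂P ≤ (1 + K) * n := by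
  rw [integral_finsetSum _ fun i _ => (h2 _).integrable one_le_two]
  calc _ ≤ (Finset.range n).card • (1 + K) := Finset.sum_le_card_nsmul _ _ _ fun i _ =>
        integral_le_one_add_of_integral_sq_le (h2 _) (hK _)
    _ = (1 + K) * n := by rw [Finset.card_range, nsmul_eq_mul, mul_comm]

lemma integrable_sum_axisEdge (h2 : ∀ e, MemLp (t e) 2 P) (n : ℕ) :
    Integrable (fun ω => ∑ i ∈ Finset.range n, t (axisEdge d i) ω) P :=
  integrable_finsetSum _ fun _ _ => (h2 _).integrable one_le_two

lemma integral_minTime_le (ht : ∀ e, Measurable (t e)) (h0 : ∀ᵐ ω ∂P, ∀ e, 0 ≤ t e ω)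
    (h2 : ∀ e, MemLp (t e) 2 P) (hK : ∀ e, ∫ ω, t e ω ^ 2 ∂P ≤ K) (n : ℕ) :
    ∫ ω, minTime t n ω ∂P ≤ (1 + K) * n :=
  (integral_mono_ae ((memLp_minTime ht h0 h2 n).integrable one_le_two)
    (integrable_sum_axisEdge h2 n) (h0.mono fun _ hω => minTime_le_sum_axisEdge hω n)).trans
    (integral_sum_axisEdge_le h2 hK n)

lemma variance_minTime_succ_sub_le (ht : ∀ e, Measurable (t e)) (h0 : ∀ᵐ ω ∂P, ∀ e, 0 ≤ t e ω)
    (h2 : ∀ e, MemLp (t e) 2 P) (hK : ∀ e, ∫ ω, t e ω ^ 2 ∂P ≤ K) (n : ℕ) :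
    Var[minTime t (n + 1) - minTime t n; P] ≤ K := by
  have hL (n : ℕ) : MemLp (minTime t n) 2 P := memLp_minTime ht h0 h2 n
  calc _ ≤ ∫ ω, (minTime t (n + 1) ω - minTime t n ω) ^ 2 ∂P :=
        variance_le_expectation_sq ((hL _).sub (hL n)).1
    _ ≤ ∫ ω, t (axisEdge d n) ω ^ 2 ∂P :=
        integral_mono_ae ((hL _).sub (hL n)).integrable_sq (h2 _).integrable_sq
          (h0.mono fun ω hω => sq_le_sq' (neg_le_of_abs_le (abs_minTime_succ_sub_le hω n))
            (le_of_abs_le (abs_minTime_succ_sub_le hω n)))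
    _ ≤ K := hK _

theorem linearVariance_of_mul_length_le (ht : ∀ e, Measurable (t e)) (hindep : iIndepFun t P)
    (h0 : ∀ᵐ ω ∂P, ∀ e, 0 ≤ t e ω) (h2 : ∀ e, MemLp (t e) 2 P)
    (hK : ∀ e, ∫ ω, t e ω ^ 2 ∂P ≤ K) {a : ℝ} (ha : 0 < a) {R : Ω → ℝ} (hR : Integrable R P)
    (hlen : ∀ᵐ ω ∂P, ∀ (y : Fin d → ℤ) (π : (lattice d).Path 0 y),
      a * π.1.length ≤ walkTime (t · ω) π.1 + R ω) : LinearVariance P t := by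
  have hK0 : 0 ≤ K := (integral_nonneg fun ω => sq_nonneg _).trans (hK (axisEdge d 0))
  refine ⟨K * ((1 + K + |∫ ω, R ω ∂P|) / a) + 1, by positivity, fun n hn => ?_⟩
  obtain ⟨w, hw⟩ := exists_walk_walkTime_eq_sum_axisEdge (d := d) n
  have hN : Integrable (fun ω => (∑ i ∈ Finset.range n, t (axisEdge d i) ω + R ω) / a) P :=
    ((integrable_sum_axisEdge h2 n).add hR).div_const a
  have hvar := variance_iInf_sum_le ht hindep h0 h2 hK hK0
    (fun π : (lattice d).Path 0 (axisPoint d n) => walkEdges π.1) w.toPath hN <| by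
      filter_upwards [h0, hlen] with ω hω hωlen π hπ
      rw [← walkTime_eq_sum (t · ω) π.2.isTrail,
        ← walkTime_eq_sum (t · ω) w.toPath.2.isTrail] at hπ
      rw [card_walkEdges π.2.isTrail, le_div_iff₀' ha]
      linarith [hωlen _ π, walkTime_toPath_le hω w, hw (t · ω)]
  rw [← minTime_eq_iInf_sum, integral_div, integral_add (integrable_sum_axisEdge h2 n) hR] at hvar
  have hn1 : (1 : ℝ) ≤ n := by exact_mod_cast hn
  calc Var[minTime t n; P]
      ≤ K * (((1 + K) * n + |∫ ω, R ω ∂P| * n) / a) := by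
        refine hvar.trans ?_
        gcongr
        · exact integral_sum_axisEdge_le h2 hK n
        · exact (le_abs_self _).trans (le_mul_of_one_le_right (abs_nonneg _) hn1)
    _ = K * ((1 + K + |∫ ω, R ω ∂P|) / a) * n := by ring
    _ ≤ (K * ((1 + K + |∫ ω, R ω ∂P|) / a) + 1) * n := by linarith

theorem LinearVariance.convergesAS (hvar : LinearVariance P t) (ht : ∀ e, Measurable (t e))
    (h0 : ∀ᵐ ω ∂P, ∀ e, 0 ≤ t e ω) (h2 : ∀ e, MemLp (t e) 2 P)
    (hK : ∀ e, ∫ ω, t e ω ^ 2 ∂P ≤ K) : ConvergesAS P t := by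
  obtain ⟨C, -, hC⟩ := hvar
  have hint (n : ℕ) := (memLp_minTime ht h0 h2 n).integrable one_le_two
  refine ae_tendsto_div_of_integral_sq_le (C := C) (K := K)
    (fun n => (memLp_minTime ht h0 h2 n).sub (memLp_const _)) (fun n hn => ?_) fun n => ?_
  · rw [← variance_eq_integral (measurable_minTime ht n).aemeasurable]
    exact hC n hn
  · have hstep := variance_minTime_succ_sub_le ht h0 h2 hK n
    rw [variance_eq_integral ((hint (n + 1)).sub (hint n)).1.aemeasurable,
      integral_sub' (hint (n + 1)) (hint n)] at hstep
    simpa only [Pi.sub_apply, sub_sub_sub_comm] using hstep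

theorem LinearVariance.convergesInLp_two (hvar : LinearVariance P t)
    (ht : ∀ e, Measurable (t e)) (hT : ∀ n, MemLp (minTime t n) 2 P) : ConvergesInLp 2 P t := by
  obtain ⟨C, -, hC⟩ := hvar
  refine ⟨hT, tendsto_eLpNorm_two_of_integral_sq (fun n => memLp_centredTime (hT n)) ?_⟩
  refine squeeze_zero' (Eventually.of_forall fun n => integral_nonneg fun ω => sq_nonneg _) ?_
    (tendsto_const_div_atTop_nhds_zero_nat C)
  filter_upwards [eventually_ge_atTop 1] with n hn
  have hn0 : (0 : ℝ) < n := by exact_mod_cast hn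
  simp only [centredTime, div_pow, integral_div]
  rw [← variance_eq_integral (measurable_minTime ht n).aemeasurable, div_le_iff₀ (pow_pos hn0 2)]
  exact (hC n hn).trans_eq (by field_simp)

theorem nontrivialGrowth_of_mul_length_le (ht : ∀ e, Measurable (t e))
    (h0 : ∀ᵐ ω ∂P, ∀ e, 0 ≤ t e ω) (h2 : ∀ e, MemLp (t e) 2 P)
    (hK : ∀ e, ∫ ω, t e ω ^ 2 ∂P ≤ K) {a : ℝ} (ha : 0 < a) {R : Ω → ℝ}
    (hlen : ∀ᵐ ω ∂P, ∀ (y : Fin d → ℤ) (π : (lattice d).Path 0 y),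
      a * π.1.length ≤ walkTime (t · ω) π.1 + R ω) (has : ConvergesAS P t) :
    NontrivialGrowth P t := by
  refine ⟨a, max a (1 + K), ha, le_max_left _ _, ?_⟩
  filter_upwards [hlen, has] with ω hω hconv
  refine ⟨le_liminf_div_of_mul_sub_le (b := R ω) fun n => le_ciInf fun π => ?_,
    liminf_le_limsup, ?_⟩
  · have hn : (n : ℝ) ≤ π.1.length := by exact_mod_cast le_length_of_walk_axisPoint π.1
    linarith [hω _ π, mul_le_mul_of_nonneg_left hn ha.le]
  · exact (limsup_div_le_of_le_mul hconv (integral_minTime_le ht h0 h2 hK)).trans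
      (EReal.coe_le_coe_iff.2 (le_max_right a (1 + K)))

end FirstPassage

end FPP

theorem theorem1_general {d : ℕ} [NeZero d] {Ω : Type*} [MeasurableSpace Ω] (P : Measure Ω)
    [IsProbabilityMeasure P] (t : FPP.Edge d → Ω → ℝ) (ht : ∀ e, Measurable (t e))
    (hindep : iIndepFun t P) (h0 : ∀ᵐ ω ∂P, ∀ e, 0 ≤ t e ω) {ε : ℝ} (hε : 0 < ε)
    (hlt : ⨆ e, P {ω | t e ω < ε} < (2 * d : ℝ≥0∞)⁻¹) (h : FPP.BoundedSecondMoments P t) :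
    FPP.ConvergesAS P t ∧ FPP.ConvergesInLp 2 P t ∧ FPP.LinearVariance P t ∧
      FPP.NontrivialGrowth P t := by
  have h2 := h.memLp ht
  obtain ⟨K, hK⟩ := h.exists_integral_sq_le ht
  obtain ⟨a, R, ha, hR, hlen⟩ := FPP.exists_mul_length_le_walkTime_add ht hindep h0 hε hlt
  have hvar := FPP.linearVariance_of_mul_length_le ht hindep h0 h2 hK ha hR hlen
  have has := hvar.convergesAS ht h0 h2 hK
  exact ⟨has, hvar.convergesInLp_two ht (FPP.memLp_minTime ht h0 h2), hvar,
    FPP.nontrivialGrowth_of_mul_length_le ht h0 h2 hK ha hlen has⟩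

theorem theorem1 {d : ℕ} [NeZero d] {Ω : Type*} [MeasurableSpace Ω] (P : Measure Ω)
    [IsProbabilityMeasure P] (t : FPP.Edge d → Ω → ℝ) (ht : ∀ e, Measurable (t e))
    (hindep : iIndepFun t P) (hi : FPP.NoMassNearZero P t) :
    (FPP.BoundedSecondMoments P t →
      FPP.ConvergesAS P t ∧ FPP.ConvergesInLp 1 P t ∧ FPP.NontrivialGrowth P t) ∧
    (FPP.UnifIntegrableSquares P t →
      FPP.ConvergesAS P t ∧ FPP.ConvergesInLp 2 P t ∧ FPP.NontrivialGrowth P t) ∧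
    (FPP.BoundedHigherMoments P t →
      FPP.ConvergesAS P t ∧ FPP.ConvergesInLp 2 P t ∧ FPP.LinearVariance P t ∧
        FPP.NontrivialGrowth P t) := by
  have h0 := hi.ae_nonneg
  obtain ⟨ε, hε, hlt⟩ := hi.exists_iSup_measure_lt (show 0 < (2 * d : ℝ≥0∞)⁻¹ by
    simp [ENNReal.mul_eq_top])
  have hgen := theorem1_general P t ht hindep h0 hε hlt
  refine ⟨fun h => ?_, fun h => ?_, fun h => hgen (h.boundedSecondMoments h0)⟩
  · obtain ⟨has, hL2, -, hgrowth⟩ := hgen h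
    exact ⟨has, hL2.mono_exponent one_le_two, hgrowth⟩
  · obtain ⟨has, hL2, -, hgrowth⟩ := hgen (h.boundedSecondMoments ht h0)
    exact ⟨has, hL2, hgrowth⟩
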